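/- Let $X$ be a complex Banach space and let $T=(T(t))_{t\ge 0}$ be a $C_0$-semigroup of bounded linear operators on $X$ with infinitesimal generator $A\colon D(A)\subset X\to X$, that is, $D(A)$ is the set of all $x\in X$ for which the limit $Ax=\lim_{h\to 0^+}h^{-1}(T(h)x-x)$ exists. Write $\rho(A)$ for the resolvent set of $A$, that is, the set of all $\lambda\in\mathbb{C}$ for which $A-\lambda I\colon D(A)\to X$ has a bounded inverse $R(\lambda,A)=(A-\lambda I)^{-1}$ defined on all of $X$. If $T$ is hyperbolic, that is, $\sigma(T(1))\cap\{z\in\mathbb{C}:|z|=1\}=\emptyset$, then $$i\mathbb{R}\subset\rho(A)\qquad\text{and}\qquad \sup_{\lambda\in i\mathbb{R}}\|R(\lambda,A)\|<\infty .$$ -/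

import Mathlib

open Set Filter Topology
open scoped NNReal

/-- A `C₀`-semigroup (strongly continuous one-parameter semigroup) of bounded linear operators
on a complex normed space `X`, indexed by `t ∈ [0, ∞)`. -/
structure C0Semigroup (X : Type*) [NormedAddCommGroup X] [NormedSpace ℂ X] where
  /-- The operators `T(t)` of the semigroup. -/
  toFun : ℝ≥0 → X →L[ℂ] X
  map_zero' : toFun 0 = 1
  map_add' : ∀ s t : ℝ≥0, toFun (s + t) = toFun s * toFun t
  continuous_orbit' : ∀ x : X, Continuous fun t : ℝ≥0 => toFun t x

namespace C0Semigroup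

variable {X : Type*} [NormedAddCommGroup X] [NormedSpace ℂ X]

instance : CoeFun (C0Semigroup X) (fun _ => ℝ≥0 → X →L[ℂ] X) := ⟨C0Semigroup.toFun⟩

/-- The semigroup is hyperbolic: the spectrum of `T(1)` does not meet the unit circle. -/
def IsHyperbolic (T : C0Semigroup X) : Prop :=
  spectrum ℂ (T 1) ∩ {z : ℂ | ‖z‖ = 1} = ∅

/-- `y` is the limit of `h⁻¹ (T(h) x - x)` as `h → 0`, `h > 0`. -/
def HasGenerator (T : C0Semigroup X) (x y : X) : Prop :=
  Tendsto (fun h : ℝ≥0 => ((h : ℝ) : ℂ)⁻¹ • (T h x - x)) (𝓝[>] 0) (𝓝 y)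

theorem HasGenerator.add {T : C0Semigroup X} {x y x' y' : X}
    (h : T.HasGenerator x y) (h' : T.HasGenerator x' y') : T.HasGenerator (x + x') (y + y') := by
  refine (Tendsto.add h h').congr fun t => ?_
  rw [← smul_add, map_add]
  congr 1
  abel

theorem HasGenerator.smul {T : C0Semigroup X} {x y : X} (c : ℂ)
    (h : T.HasGenerator x y) : T.HasGenerator (c • x) (c • y) := by
  refine (Tendsto.const_smul h c).congr fun t => ?_
  rw [map_smul, ← smul_sub, smul_comm]

theorem HasGenerator.zero (T : C0Semigroup X) : T.HasGenerator 0 0 := by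
  simp [HasGenerator]

theorem HasGenerator.unique {T : C0Semigroup X} {x y y' : X}
    (h : T.HasGenerator x y) (h' : T.HasGenerator x y') : y = y' :=
  tendsto_nhds_unique h h'

/-- The infinitesimal generator `A : D(A) ⊆ X → X` of the semigroup: `D(A)` is the set of all `x`
for which the limit of `h⁻¹ (T(h) x - x)` as `h → 0+` exists, and `A x` is that limit. -/
noncomputable def generator (T : C0Semigroup X) : X →ₗ.[ℂ] X where
  domain :=
    { carrier := {x | ∃ y, T.HasGenerator x y}
      add_mem' := fun ⟨_, h⟩ ⟨_, h'⟩ => ⟨_, h.add h'⟩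
      zero_mem' := ⟨0, HasGenerator.zero T⟩
      smul_mem' := fun c _ ⟨_, h⟩ => ⟨_, h.smul c⟩ }
  toFun :=
    { toFun := fun x => Classical.choose x.2
      map_add' := fun x x' =>
        (Classical.choose_spec (x + x').2).unique
          ((Classical.choose_spec x.2).add (Classical.choose_spec x'.2))
      map_smul' := fun c x =>
        (Classical.choose_spec (c • x).2).unique ((Classical.choose_spec x.2).smul c) }

theorem mem_generator_domain_iff (T : C0Semigroup X) (x : X) :
    x ∈ T.generator.domain ↔ ∃ y, T.HasGenerator x y := Iff.rfl

theorem hasGenerator_generator (T : C0Semigroup X) (x : T.generator.domain) :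
    T.HasGenerator x (T.generator x) := Classical.choose_spec x.2

end C0Semigroup

namespace UnboundedOperator

variable {X : Type*} [NormedAddCommGroup X] [NormedSpace ℂ X]

/-- The everywhere defined bounded operator `R` is the inverse of `A - z I : D(A) → X`. -/
structure IsInverseSub (A : X →ₗ.[ℂ] X) (z : ℂ) (R : X →L[ℂ] X) : Prop where
  mem_domain : ∀ y : X, R y ∈ A.domain
  right_inv : ∀ y : X, A ⟨R y, mem_domain y⟩ - z • R y = y
  left_inv : ∀ x : A.domain, R (A x - z • (x : X)) = x

/-- The resolvent set `ρ(A)`: all `z` for which `A - z I : D(A) → X` has a bounded inverse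
defined on the whole of `X`. -/
def resolventSet (A : X →ₗ.[ℂ] X) : Set ℂ :=
  {z | ∃ R : X →L[ℂ] X, IsInverseSub A z R}

open Classical in
/-- The resolvent operator `R(z, A) = (A - z I)⁻¹` for `z ∈ ρ(A)`
(with the value `0` elsewhere). -/
noncomputable def resolvent (A : X →ₗ.[ℂ] X) (z : ℂ) : X →L[ℂ] X :=
  if h : z ∈ resolventSet A then Classical.choose h else 0

theorem IsInverseSub.unique {A : X →ₗ.[ℂ] X} {z : ℂ} {R S : X →L[ℂ] X}
    (hR : IsInverseSub A z R) (hS : IsInverseSub A z S) : R = S := by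
  ext y
  have h := hR.left_inv ⟨S y, hS.mem_domain y⟩
  rwa [hS.right_inv y] at h

theorem isInverseSub_resolvent {A : X →ₗ.[ℂ] X} {z : ℂ} (h : z ∈ resolventSet A) :
    IsInverseSub A z (resolvent A z) := by
  rw [resolvent, dif_pos h]
  exact Classical.choose_spec h

end UnboundedOperator

/-! For `z` on the imaginary axis let `L = ∫₀¹ e^{-zs} T(s) ds`. Integrating the generator along
orbits gives `(A - z) L = e^{-z} T(1) - 1` on `X` (`hasGenerator_truncatedLaplace`) and the same
value for `L (A - z)` on `D(A)` (`truncatedLaplace_generator_sub`). Since `|e^z| = 1`, hyperbolicity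
makes `e^z - T(1)` invertible, and `L` commutes with it, so `-e^z L (e^z - T(1))⁻¹` inverts `A - z`
(`isInverseSub_generator`). The bound is uniform in `z`: `‖L‖` is at most a bound of `‖T(s)‖` on
`[0, 1]`, and the resolvent of `T(1)` is continuous on the compact unit circle. -/

namespace C0Semigroup

variable {X : Type*} [NormedAddCommGroup X] [NormedSpace ℂ X]

/-- The semigroup operators are uniformly bounded on `[0, 1]`. -/
theorem exists_norm_le [CompleteSpace X] (T : C0Semigroup X) :
    ∃ M : ℝ, 0 ≤ M ∧ ∀ t : ℝ≥0, t ≤ 1 → ‖T t‖ ≤ M := by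
  obtain ⟨M, hM⟩ := banach_steinhaus (g := fun t : Icc (0 : ℝ≥0) 1 => T t) fun x => by
    obtain ⟨C, hC⟩ := (isCompact_Icc (a := (0 : ℝ≥0)) (b := 1)).exists_bound_of_continuousOn
      (T.continuous_orbit' x).continuousOn
    exact ⟨C, fun t => hC t t.2⟩
  exact ⟨M, (norm_nonneg _).trans (hM ⟨0, by simp⟩), fun t ht => hM ⟨t, zero_le, ht⟩⟩

/-! ### Integrals of rescaled orbits over `[0, 1]` -/

/-- The orbit `s ↦ e^{-zs} T(s) x` of the rescaled semigroup, extended to negative times. -/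
noncomputable def rescaledOrbit (T : C0Semigroup X) (z : ℂ) (x : X) (s : ℝ) : X :=
  Complex.exp (-z * s) • T s.toNNReal x

theorem continuous_rescaledOrbit (T : C0Semigroup X) (z : ℂ) (x : X) :
    Continuous (T.rescaledOrbit z x) := by
  have h := (T.continuous_orbit' x).comp continuous_real_toNNReal
  exact Continuous.smul (by fun_prop) h

theorem rescaledOrbit_add_arg (T : C0Semigroup X) (z : ℂ) (x : X) (h : ℝ≥0) {s : ℝ}
    (hs : 0 ≤ s) :
    Complex.exp (-z * (h : ℝ)) • T h (T.rescaledOrbit z x s) = T.rescaledOrbit z x (s + h) := by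
  -- `0 ≤ s` is essential: `Real.toNNReal` sends negative times to `0`, which breaks additivity.
  have e : (s + h).toNNReal = h + s.toNNReal := by
    rw [Real.toNNReal_add hs h.coe_nonneg, Real.toNNReal_coe, add_comm]
  rw [rescaledOrbit, rescaledOrbit, e, T.map_add', map_smul, smul_smul, ← Complex.exp_add]
  congr 2
  push_cast
  ring

theorem apply_rescaledOrbit (T : C0Semigroup X) (z : ℂ) (x : X) (h : ℝ≥0) (s : ℝ) :
    T h (T.rescaledOrbit z x s) = T.rescaledOrbit z (T h x) s := by
  rw [rescaledOrbit, rescaledOrbit, map_smul, ← mul_apply_eq_comp,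
    ← mul_apply_eq_comp, ← T.map_add', ← T.map_add', add_comm]

theorem norm_rescaledOrbit_le (T : C0Semigroup X) {z : ℂ} (hz : z.re = 0) {M : ℝ}
    (hM : ∀ t : ℝ≥0, t ≤ 1 → ‖T t‖ ≤ M) (x : X) {s : ℝ} (hs : s ≤ 1) :
    ‖T.rescaledOrbit z x s‖ ≤ M * ‖x‖ := by
  rw [rescaledOrbit, norm_smul, Complex.norm_exp]
  simp only [Complex.mul_re, Complex.neg_re, hz, Complex.ofReal_im, mul_zero, neg_zero, zero_mul,
    sub_zero, Real.exp_zero, one_mul]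
  exact (T s.toNNReal).le_of_opNorm_le (hM _ (by simpa using hs)) x

/-- The integral `∫₀¹ e^{-zs} T(s) x ds`. -/
noncomputable def truncatedLaplace (T : C0Semigroup X) (z : ℂ) (x : X) : X :=
  ∫ s in (0 : ℝ)..1, T.rescaledOrbit z x s

theorem norm_truncatedLaplace_le (T : C0Semigroup X) {z : ℂ} (hz : z.re = 0) {M : ℝ}
    (hM : ∀ t : ℝ≥0, t ≤ 1 → ‖T t‖ ≤ M) (x : X) : ‖T.truncatedLaplace z x‖ ≤ M * ‖x‖ := by
  have h := intervalIntegral.norm_integral_le_of_norm_le_const (a := (0 : ℝ)) (b := 1)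
    (f := T.rescaledOrbit z x) (C := M * ‖x‖) fun s hs =>
      T.norm_rescaledOrbit_le hz hM x (by simpa using hs.2)
  simpa [truncatedLaplace] using h

theorem truncatedLaplace_add (T : C0Semigroup X) (z : ℂ) (x y : X) :
    T.truncatedLaplace z (x + y) = T.truncatedLaplace z x + T.truncatedLaplace z y := by
  rw [truncatedLaplace, truncatedLaplace, truncatedLaplace, ← intervalIntegral.integral_add
    ((T.continuous_rescaledOrbit z x).intervalIntegrable _ _)
    ((T.continuous_rescaledOrbit z y).intervalIntegrable _ _)]
  simp [rescaledOrbit]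

theorem truncatedLaplace_smul (T : C0Semigroup X) (z c : ℂ) (x : X) :
    T.truncatedLaplace z (c • x) = c • T.truncatedLaplace z x := by
  rw [truncatedLaplace, truncatedLaplace, ← intervalIntegral.integral_smul]
  simp [rescaledOrbit, smul_comm _ c]

/-- On the imaginary axis, `x ↦ ∫₀¹ e^{-zs} T(s) x ds` is a bounded operator with the same bound
as the semigroup on `[0, 1]`. -/
theorem exists_truncatedLaplaceCLM (T : C0Semigroup X) {z : ℂ} (hz : z.re = 0) {M : ℝ}
    (hM₀ : 0 ≤ M) (hM : ∀ t : ℝ≥0, t ≤ 1 → ‖T t‖ ≤ M) :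
    ∃ L : X →L[ℂ] X, ‖L‖ ≤ M ∧ ∀ x, L x = T.truncatedLaplace z x :=
  ⟨LinearMap.mkContinuous
    { toFun := T.truncatedLaplace z
      map_add' := T.truncatedLaplace_add z
      map_smul' := T.truncatedLaplace_smul z } M (T.norm_truncatedLaplace_le hz hM),
    LinearMap.mkContinuous_norm_le _ hM₀ _, fun _ => rfl⟩

theorem apply_truncatedLaplace [CompleteSpace X] (T : C0Semigroup X) (z : ℂ) (x : X) (h : ℝ≥0) :
    T h (T.truncatedLaplace z x) = T.truncatedLaplace z (T h x) := by
  rw [truncatedLaplace, truncatedLaplace, ← ContinuousLinearMap.intervalIntegral_comp_comm _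
    ((T.continuous_rescaledOrbit z x).intervalIntegrable _ _)]
  simp only [apply_rescaledOrbit]

/-- The rescaled semigroup shifts the window `[0, 1]` to `[h, 1 + h]`; the overlap cancels and only
two end pieces of length `h` remain. -/
theorem exp_smul_apply_truncatedLaplace_sub [CompleteSpace X] (T : C0Semigroup X) (z : ℂ) (x : X)
    (h : ℝ≥0) :
    Complex.exp (-z * (h : ℝ)) • T h (T.truncatedLaplace z x) - T.truncatedLaplace z x =
      (∫ s in (1 : ℝ)..1 + h, T.rescaledOrbit z x s) - ∫ s in (0 : ℝ)..h, T.rescaledOrbit z x s := by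
  have hi (a b : ℝ) : IntervalIntegrable (T.rescaledOrbit z x) MeasureTheory.volume a b :=
    (T.continuous_rescaledOrbit z x).intervalIntegrable a b
  have e : Complex.exp (-z * (h : ℝ)) • T h (T.truncatedLaplace z x) =
      ∫ s in (0 : ℝ) + h..1 + h, T.rescaledOrbit z x s := by
    rw [truncatedLaplace, ← ContinuousLinearMap.intervalIntegral_comp_comm _ (hi _ _),
      ← intervalIntegral.integral_smul, ← intervalIntegral.integral_comp_add_right]
    refine intervalIntegral.integral_congr fun s hs => ?_
    rw [uIcc_of_le zero_le_one] at hs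
    exact T.rescaledOrbit_add_arg z x h hs.1
  rw [e, truncatedLaplace, zero_add,
    intervalIntegral.integral_interval_sub_interval_comm (hi _ _) (hi _ _) (hi _ _),
    intervalIntegral.integral_symm, intervalIntegral.integral_symm (1 + (h : ℝ)) 1]
  abel

/-! ### The generator on these integrals -/

theorem tendsto_coe_nhdsGT_zero :
    Tendsto (fun h : ℝ≥0 => (h : ℝ)) (𝓝[>] 0) (𝓝[>] 0) := by
  refine tendsto_nhdsWithin_iff.2 ⟨?_, ?_⟩
  · exact (NNReal.continuous_coe.tendsto' 0 0 rfl).mono_left nhdsWithin_le_nhds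
  · filter_upwards [self_mem_nhdsWithin] with h hh
    exact_mod_cast hh

theorem tendsto_inv_smul_sub {E : Type*} [NormedAddCommGroup E] [NormedSpace ℂ E]
    [NormedSpace ℝ E] [IsScalarTower ℝ ℂ E] {f : ℝ → E} {f' : E} {a : ℝ} (hf : HasDerivAt f f' a) :
    Tendsto (fun h : ℝ≥0 => ((h : ℝ) : ℂ)⁻¹ • (f (a + h) - f a)) (𝓝[>] 0) (𝓝 f') := by
  have h := (hasDerivAt_iff_tendsto_slope_zero.1 hf).mono_left
    (nhdsWithin_mono _ fun t (ht : 0 < t) => ht.ne')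
  refine (h.comp tendsto_coe_nhdsGT_zero).congr fun t => ?_
  simp only [Function.comp_apply]
  rw [← Complex.ofReal_inv, ← algebraMap_smul ℂ ((t : ℝ)⁻¹)]
  rfl

/-- If `e^{-zt} T(t)` has generator value `w` at `v`, then `T` has generator value `w + z v`. -/
theorem hasGenerator_of_rescaled (T : C0Semigroup X) (z : ℂ) {v w : X}
    (hw : Tendsto (fun h : ℝ≥0 => ((h : ℝ) : ℂ)⁻¹ • (Complex.exp (-z * (h : ℝ)) • T h v - v))
      (𝓝[>] 0) (𝓝 w)) : T.HasGenerator v (w + z • v) := by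
  have hd : HasDerivAt (fun t : ℝ => Complex.exp (z * t)) z 0 := by
    have := ((Complex.ofRealCLM.hasDerivAt (x := 0)).const_mul z).cexp
    simpa using this
  have hq := tendsto_inv_smul_sub hd
  have hc : Tendsto (fun h : ℝ≥0 => Complex.exp (z * (h : ℝ))) (𝓝[>] 0) (𝓝 1) :=
    (Continuous.tendsto' (by fun_prop) 0 1 (by simp)).mono_left nhdsWithin_le_nhds
  -- Product rule: `T(h)v - v = e^{zh} (e^{-zh} T(h)v - v) + (e^{zh} - 1) v`.
  have key := (hc.smul hw).add (hq.smul_const v)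
  rw [one_smul] at key
  refine key.congr fun h => ?_
  have e : Complex.exp (z * (h : ℝ)) * Complex.exp (-z * (h : ℝ)) = 1 := by
    rw [← Complex.exp_add]; simp
  rw [smul_comm (Complex.exp (z * (h : ℝ))), smul_assoc, ← smul_add, smul_sub, smul_smul, e]
  simp [sub_smul]

/-- Divided by `h`, the two end pieces converge to the orbit's values at `1` and `0`. Only
continuity of the orbit is used, so `x` need not lie in `D(A)`. -/
theorem hasGenerator_truncatedLaplace [CompleteSpace X] (T : C0Semigroup X) (z : ℂ) (x : X) :
    T.HasGenerator (T.truncatedLaplace z x)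
      (Complex.exp (-z) • T 1 x - x + z • T.truncatedLaplace z x) := by
  apply T.hasGenerator_of_rescaled
  have hF := T.continuous_rescaledOrbit z x
  have hd (a : ℝ) : HasDerivAt (fun t => ∫ s in a..t, T.rescaledOrbit z x s)
      (T.rescaledOrbit z x a) a :=
    intervalIntegral.integral_hasDerivAt_right (hF.intervalIntegrable _ _)
      (hF.stronglyMeasurableAtFilter _ _) hF.continuousAt
  have key := (tendsto_inv_smul_sub (hd 1)).sub (tendsto_inv_smul_sub (hd 0))
  have e₁ : T.rescaledOrbit z x 1 = Complex.exp (-z) • T 1 x := by simp [rescaledOrbit]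
  have e₀ : T.rescaledOrbit z x 0 = x := by simp [rescaledOrbit, T.map_zero']
  rw [e₁, e₀] at key
  refine key.congr fun h => ?_
  rw [exp_smul_apply_truncatedLaplace_sub, ← smul_sub]
  simp

/-- `∫₀¹ e^{-zs} T(s) ds` maps `(A - z) x` to `(e^{-z} T(1) - 1) x`. -/
theorem truncatedLaplace_generator_sub [CompleteSpace X] (T : C0Semigroup X) {z : ℂ}
    {L : X →L[ℂ] X} (hL : ∀ x, L x = T.truncatedLaplace z x) {x y : X} (h : T.HasGenerator x y) :
    L (y - z • x) = Complex.exp (-z) • T 1 x - x := by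
  -- `L` is bounded and commutes with `T(h)`, so it carries the difference quotients of `x` to those
  -- of `L x`.
  have h₁ : T.HasGenerator (T.truncatedLaplace z x) (L y) := by
    refine ((L.continuous.tendsto y).comp h).congr fun t => ?_
    rw [Function.comp_apply, map_smul, map_sub, hL, hL, apply_truncatedLaplace]
  rw [map_sub, map_smul, h₁.unique (T.hasGenerator_truncatedLaplace z x), hL]
  abel

/-! ### Hyperbolicity and the resolvent of the generator -/

theorem IsHyperbolic.mem_resolventSet {T : C0Semigroup X} (hT : T.IsHyperbolic) {w : ℂ}
    (hw : ‖w‖ = 1) : w ∈ _root_.resolventSet ℂ (T 1) := by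
  by_contra h
  have : w ∈ spectrum ℂ (T 1) ∩ {z : ℂ | ‖z‖ = 1} := ⟨h, hw⟩
  rw [hT] at this
  exact this

/-- The resolvent of `T(1)` is bounded on the unit circle. -/
theorem exists_norm_resolvent_le [CompleteSpace X] (T : C0Semigroup X) (hT : T.IsHyperbolic) :
    ∃ C : ℝ, ∀ w : ℂ, ‖w‖ = 1 → ‖_root_.resolvent (T 1) w‖ ≤ C := by
  obtain ⟨C, hC⟩ := (isCompact_sphere (0 : ℂ) 1).exists_bound_of_continuousOn
    (f := _root_.resolvent (T 1)) fun w hw => by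
      have hw' := hT.mem_resolventSet (by simpa using hw : ‖w‖ = 1)
      exact (spectrum.hasDerivAt_resolvent_const_left hw').continuousAt.continuousWithinAt
  exact ⟨C, fun w hw => hC w (by simpa using hw)⟩

/-- `-e^z (∫₀¹ e^{-zs} T(s) ds) (e^z - T(1))⁻¹` is the inverse of `A - z`. -/
theorem isInverseSub_generator [CompleteSpace X] (T : C0Semigroup X) {z : ℂ}
    {L : X →L[ℂ] X} (hL : ∀ x, L x = T.truncatedLaplace z x)
    (hz : Complex.exp z ∈ _root_.resolventSet ℂ (T 1)) :
    UnboundedOperator.IsInverseSub T.generator z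
      (-Complex.exp z • (L * _root_.resolvent (T 1) (Complex.exp z))) := by
  set Q := _root_.resolvent (T 1) (Complex.exp z) with hQ
  have hu : IsUnit (algebraMap ℂ (X →L[ℂ] X) (Complex.exp z) - T 1) := hz
  have hr : (algebraMap ℂ (X →L[ℂ] X) (Complex.exp z) - T 1) * Q = 1 := Ring.mul_inverse_cancel _ hu
  have hl : Q * (algebraMap ℂ (X →L[ℂ] X) (Complex.exp z) - T 1) = 1 := Ring.inverse_mul_cancel _ hu
  have hexp : Complex.exp z * Complex.exp (-z) = 1 := by rw [← Complex.exp_add]; simp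
  have hrx (y : X) : Complex.exp z • Q y - T 1 (Q y) = y := by
    simpa [Algebra.algebraMap_eq_smul_one] using congr($hr y)
  have hLT : L * T 1 = T 1 * L := by
    ext x; simp [hL, apply_truncatedLaplace]
  -- The right inverse comes from `L * Q`, but the left inverse needs `L` to meet `A - z` first,
  -- hence `Q * L`.
  have hcomm : L * Q = Q * L := by
    have hc : Commute L (algebraMap ℂ (X →L[ℂ] X) (Complex.exp z) - T 1) :=
      Commute.sub_right (Algebra.commutes _ L).symm hLT
    calc L * Q = Q * ((algebraMap ℂ (X →L[ℂ] X) (Complex.exp z) - T 1) * L) * Q := by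
          rw [← mul_assoc, hl, one_mul]
      _ = Q * L := by rw [← hc.eq, mul_assoc, mul_assoc, hr, mul_one]
  have hgen (y : X) : T.HasGenerator ((-Complex.exp z • (L * Q)) y)
      (y + z • (-Complex.exp z • (L * Q)) y) := by
    convert (T.hasGenerator_truncatedLaplace z (Q y)).smul (-Complex.exp z) using 1
    · simp [hL]
    · rw [smul_add, smul_sub, smul_smul, neg_mul, hexp, smul_comm _ z]
      simp only [smul_apply, mul_apply_eq_comp, hL]
      congr 1
      nth_rw 1 [← hrx y]
      module
  have hmem (y : X) : (-Complex.exp z • (L * Q)) y ∈ T.generator.domain := ⟨_, hgen y⟩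
  refine ⟨hmem, fun y => ?_, fun x => ?_⟩
  · rw [(T.hasGenerator_generator ⟨_, hmem y⟩).unique (hgen y)]
    abel
  · have h := T.truncatedLaplace_generator_sub hL (T.hasGenerator_generator x)
    have hlx : Complex.exp z • Q x - Q (T 1 x) = x := by
      simpa [Algebra.algebraMap_eq_smul_one] using congr($hl (x : X))
    rw [hcomm, smul_apply, mul_apply_eq_comp, h, map_sub, map_smul,
      smul_sub, smul_smul, neg_mul, hexp]
    nth_rw 3 [← hlx]
    module

end C0Semigroup

theorem corollary3p1 {X : Type*} [NormedAddCommGroup X] [NormedSpace ℂ X] [CompleteSpace X]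
    (T : C0Semigroup X) (hT : T.IsHyperbolic) :
    {z : ℂ | z.re = 0} ⊆ UnboundedOperator.resolventSet T.generator ∧
      BddAbove ((fun z : ℂ => ‖UnboundedOperator.resolvent T.generator z‖) ''
        {z : ℂ | z.re = 0}) := by
  obtain ⟨M, hM₀, hM⟩ := T.exists_norm_le
  obtain ⟨C, hC⟩ := T.exists_norm_resolvent_le hT
  have key (z : ℂ) (hz : z.re = 0) :
      ∃ R, UnboundedOperator.IsInverseSub T.generator z R ∧ ‖R‖ ≤ M * C := by
    obtain ⟨L, hLM, hL⟩ := T.exists_truncatedLaplaceCLM hz hM₀ hM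
    have h1 : ‖Complex.exp z‖ = 1 := by simp [Complex.norm_exp, hz]
    refine ⟨_, T.isInverseSub_generator hL (hT.mem_resolventSet h1), ?_⟩
    rw [norm_smul, norm_neg, h1, one_mul]
    exact (norm_mul_le _ _).trans (mul_le_mul hLM (hC _ h1) (norm_nonneg _) hM₀)
  refine ⟨fun z hz => ?_, M * C, ?_⟩
  · obtain ⟨R, hR, -⟩ := key z hz
    exact ⟨R, hR⟩
  · rintro _ ⟨z, hz, rfl⟩
    obtain ⟨R, hR, hn⟩ := key z hz
    -- `UnboundedOperator.resolvent` is a chosen inverse; uniqueness identifies it with the `R` that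
    -- is bounded by `M * C`.
    have e := (UnboundedOperator.isInverseSub_resolvent ⟨R, hR⟩).unique hR
    simpa only [e] using hn
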